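/- Let $\tau_1,\dots,\tau_N$ be sporadic tasks, where $\tau_i$ has worst-case execution time $C_i>0$, minimum inter-arrival time $T_i>0$ and relative deadline $D_i>0$, with $C_i/D_i\le 1$ and $U_i:=C_i/T_i\le 1$. Task $\tau_i$ releases an infinite sequence of jobs, from time $0$ on; consecutive releases of $\tau_i$ are separated by at least $T_i$, each job of $\tau_i$ requires an execution time of at most $C_i$, and a job of $\tau_i$ released at time $t$ has absolute deadline $t+D_i$. The tasks are executed on $M\ge 2$ identical unit-speed processors by global fixed-priority preemptive scheduling, where $\tau_i$ has higher priority than $\tau_j$ if $i<j$: at most one job of each task is executed at any time, the jobs of one task are executed in the order of their releases, and at every time the $M$ highest-priority ready jobs are executed (all of them if there are fewer than $M$), a job being ready if it has been released and is unfinished and all earlier jobs of its task are finished. Task $\tau_k$ is called schedulable if, for all releases and execution times as above, every job of $\tau_k$ finishes no later than its absolute deadline in the resulting schedule. Let $\delta_k = C_k/\min\{D_k,T_k\}$ and $U^{\max}_{\delta,k}=\max\{\max_{1\le i\le k-1}U_i,\ \delta_k\}$ (so $U^{\max}_{\delta,k}=\delta_k$ if $k=1$). Suppose that $D_k>T_k$,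 and let $b=\frac{D_k-T_k}{T_k}$. Then $\tau_k$ is schedulable in each of the following two cases: 1. $bU_k-\sum_{i=1}^{k-1}\frac{C_i-C_iU_i}{T_k}>0$ and $$\sum_{i=1}^{k}U_i\le M-(M-1)\,U^{\max}_{\delta,k};$$ 2. $bU_k-\sum_{i=1}^{k-1}\frac{C_i-C_iU_i}{T_k}\le 0$ and $$\frac{C_k}{D_k}+\sum_{i=1}^{k-1}\Big(\frac{C_i-C_iU_i}{D_k}+U_i\Big)\le M-(M-1)\,U^{\max}_{\delta,k}.$$ -/

import Mathlib

/-- A sporadic task: worst-case execution time `C`, minimum inter-arrival time (period) `T` and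
relative deadline `D`, with the standing assumptions that all three are positive, that `C / D ≤ 1`
and that the utilization `C / T` is at most `1`. The deadline is arbitrary: `D` may be smaller
than, equal to, or larger than `T`. -/
structure SporadicTask where
  C : ℝ
  T : ℝ
  D : ℝ
  C_pos : 0 < C
  T_pos : 0 < T
  D_pos : 0 < D
  C_div_D_le_one : C / D ≤ 1
  C_div_T_le_one : C / T ≤ 1

/-- Utilization `U = C / T`. -/
noncomputable def SporadicTask.U (s : SporadicTask) : ℝ := s.C / s.T

/-- Density `δ = C / min {D, T}`. -/
noncomputable def SporadicTask.density (s : SporadicTask) : ℝ := s.C / min s.D s.T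

namespace GlobalFP

variable {N : ℕ}

/-- `max {max_{i < k} U_i, δ_k}`; this is `δ_k` when there is no `i < k`. -/
noncomputable def UmaxDelta (τ : Fin N → SporadicTask) (k : Fin N) : ℝ :=
  (Finset.Iio k).fold max (τ k).density (fun i => (τ i).U)

/-- The behaviour of the jobs of a task set at run time: job `j` (`j = 0, 1, 2, …`) of task `i`
arrives at time `release i j` and needs `exec i j` units of execution time. -/
structure JobPattern (N : ℕ) where
  release : Fin N → ℕ → ℝ
  exec : Fin N → ℕ → ℝ

/-- The job patterns that a sporadic task set can generate: the system starts at time `0`, any two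
consecutive arrivals of a task are at least one period apart, and no job needs more than the
worst-case execution time of its task. -/
structure JobPattern.IsLegal (P : JobPattern N) (τ : Fin N → SporadicTask) : Prop where
  release_nonneg : ∀ i j, 0 ≤ P.release i j
  separation : ∀ i j, P.release i j + (τ i).T ≤ P.release i (j + 1)
  exec_nonneg : ∀ i j, 0 ≤ P.exec i j
  exec_le : ∀ i j, P.exec i j ≤ (τ i).C

/-- A candidate schedule: `S i j` is the set of the times at which job `j` of task `i` is being
executed, on any one of the unit-speed processors. -/
abbrev Schedule (N : ℕ) := Fin N → ℕ → Set ℝ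

/-- The amount of execution that job `j` of task `i` receives during `[0, t)`. -/
noncomputable def Schedule.service (S : Schedule N) (i : Fin N) (j : ℕ) (t : ℝ) : ℝ :=
  MeasureTheory.volume.real (S i j ∩ Set.Ico 0 t)

/-- Job `j` of task `i` has completed its execution by time `t`. -/
def Finished (P : JobPattern N) (S : Schedule N) (i : Fin N) (j : ℕ) (t : ℝ) : Prop :=
  P.exec i j ≤ S.service i j t

/-- Task `i` is active at time `t`: some job of it has arrived before or at `t` and has not
finished yet at `t`. -/
def Active (P : JobPattern N) (S : Schedule N) (i : Fin N) (t : ℝ) : Prop :=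
  ∃ j, P.release i j ≤ t ∧ ¬ Finished P S i j t

/-- Job `j` of task `i` is in the ready queue at time `t`: it has arrived, is not finished, and all
earlier jobs of its task are finished (jobs of one task are executed one after the other, in the
order of their arrivals, so there is no intra-task parallelism). -/
def Ready (P : JobPattern N) (S : Schedule N) (i : Fin N) (j : ℕ) (t : ℝ) : Prop :=
  P.release i j ≤ t ∧ ¬ Finished P S i j t ∧ ∀ j' < j, Finished P S i j' t

/-- `S` is the schedule that global fixed-priority preemptive scheduling on `M` identical
processors produces for the job pattern `P`, where a task with a smaller index has a higher
priority: at every time, exactly the `M` highest-priority jobs of the ready queue are executed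
(all of them if there are fewer than `M`). A task contributes a job to the ready queue exactly
when it is active, and then exactly one job, so a ready job of task `i` is among the `M`
highest-priority ones exactly when fewer than `M` tasks `h < i` are active. -/
structure IsGlobalFPSchedule (M : ℕ) (P : JobPattern N) (S : Schedule N) : Prop where
  measurable : ∀ i j, MeasurableSet (S i j)
  executes_iff : ∀ i j t,
    t ∈ S i j ↔ Ready P S i j t ∧ {h : Fin N | h < i ∧ Active P S h t}.ncard < M

/-- Task `τ_k` is schedulable under global fixed-priority preemptive scheduling on `M` identical
processors: in every schedule, for every legal job pattern of the task set, every job of `τ_k`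
finishes no later than its absolute deadline. -/
def Schedulable (M : ℕ) (τ : Fin N → SporadicTask) (k : Fin N) : Prop :=
  ∀ (P : JobPattern N) (S : Schedule N), P.IsLegal τ → IsGlobalFPSchedule M P S →
    ∀ j, Finished P S k j (P.release k j + (τ k).D)

end GlobalFP

open MeasureTheory Set

/-! Suppose a job of task k misses its deadline d, let a be the start of its busy period, x the time
task k runs in [a, d), and V the bound `UmaxDelta`. Whenever task k waits, M higher-priority tasks
run; since x ≤ V(d - a), the higher-priority work plus x is at least (M - (M-1)V)(d - a). Keep x
fixed and move the left end back to the earliest s at which the load still reaches this rate.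

No window ending at s is loaded at that rate. So a task with unfinished work at s, busy since u < s,
has run for more than V(s - u) ≥ U(s - u) in [u, s). This pays for its carry-in: its work in [s, d)
is at most U(d - s) + C - CU, as if it had none (`amount_running_le_of_rate`). Summing over the
tasks contradicts a load condition affine in L = d - s ≥ D_k (`finished_of_forall_lt`); the two
cases are the two signs of its constant term. -/

/-- If every point of `B` lies in at least `M` of finitely many sets, then these sets have total
measure at least `M * μ B` inside `B`. -/
theorem mul_measureReal_le_sum_inter {ι α : Type*} [MeasurableSpace α] (μ : Measure α)
    (F : Finset ι) (A : ι → Set α) (B : Set α) (M : ℕ) (hA : ∀ h ∈ F, MeasurableSet (A h))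
    (hB : MeasurableSet B) (hfin : μ B ≠ ⊤)
    (hM : ∀ x ∈ B, ∃ G ⊆ F, M ≤ G.card ∧ ∀ h ∈ G, x ∈ A h) :
    M * μ.real B ≤ ∑ h ∈ F, μ.real (A h ∩ B) := by
  have key : (M : ENNReal) * μ B ≤ ∑ h ∈ F, μ (A h ∩ B) := by
    calc (M : ENNReal) * μ B = ∫⁻ _ in B, (M : ENNReal) ∂μ := by simp
      _ ≤ ∫⁻ x in B, ∑ h ∈ F, (A h).indicator 1 x ∂μ := by
        refine setLIntegral_mono' hB fun x hx => ?_
        obtain ⟨G, hGF, hGM, hG⟩ := hM x hx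
        calc (M : ENNReal) ≤ G.card := by exact_mod_cast hGM
          _ = ∑ h ∈ G, (A h).indicator (1 : α → ENNReal) x := by
            rw [Finset.sum_congr rfl fun h hh => by rw [indicator_of_mem (hG h hh)]]
            simp
          _ ≤ _ := Finset.sum_le_sum_of_subset hGF
      _ = ∑ h ∈ F, μ (A h ∩ B) := by
        rw [lintegral_finsetSum' _ fun h hh =>
          (measurable_one.indicator (hA h hh)).aemeasurable]
        refine Finset.sum_congr rfl fun h hh => ?_
        rw [lintegral_indicator_one (hA h hh), Measure.restrict_apply (hA h hh)]
  have hne : ∀ h ∈ F, μ (A h ∩ B) ≠ ⊤ := fun h _ => measure_ne_top_of_subset inter_subset_right hfin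
  have := ENNReal.toReal_mono (ENNReal.sum_ne_top.2 hne) key
  rwa [ENNReal.toReal_mul, ENNReal.toReal_sum hne, ENNReal.toReal_natCast] at this

/-! ### Measure of a set of times inside a window -/

/-- The measure of the part of `A` in `[s, t)`. -/
noncomputable def amount (A : Set ℝ) (s t : ℝ) : ℝ := volume.real (A ∩ Ico s t)

theorem amount_nonneg (A : Set ℝ) (s t : ℝ) : 0 ≤ amount A s t := measureReal_nonneg

theorem volume_inter_Ico_ne_top (A : Set ℝ) (s t : ℝ) : volume (A ∩ Ico s t) ≠ ⊤ :=
  measure_ne_top_of_subset inter_subset_right (by simp)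

theorem amount_le_of_inter_subset {A B : Set ℝ} {s t u v : ℝ} (h : A ∩ Ico s t ⊆ B ∩ Ico u v) :
    amount A s t ≤ amount B u v :=
  measureReal_mono h (volume_inter_Ico_ne_top B u v)

theorem amount_le_sub (A : Set ℝ) {s t : ℝ} (h : s ≤ t) : amount A s t ≤ t - s := by
  have := measureReal_mono (μ := volume) (inter_subset_right : A ∩ Ico s t ⊆ Ico s t) (by simp)
  rwa [Real.volume_real_Ico_of_le h] at this

theorem amount_add {A : Set ℝ} {s t u : ℝ} (hst : s ≤ t) (htu : t ≤ u) :
    amount A s t + amount A t u = amount A s u := by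
  have := measureReal_inter_add_sdiff (μ := volume) (s := A ∩ Ico s u)
    (measurableSet_Iio (a := t)) (volume_inter_Ico_ne_top A s u)
  rw [amount, amount, amount, ← this]
  congr 2
  · ext x; simp only [mem_inter_iff, mem_Ico, mem_Iio]; grind
  · ext x; simp only [mem_inter_iff, mem_Ico, mem_sdiff, mem_Iio]; grind

theorem amount_eq_zero {A : Set ℝ} {s t : ℝ} (h : ∀ x ∈ A, s ≤ x → ¬ x < t) :
    amount A s t = 0 := by
  have : A ∩ Ico s t = ∅ := by ext x; simp; grind
  simp [amount, this]

/-- Needed so that an earliest start of a loaded window exists. -/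
theorem continuousOn_amount_left (A : Set ℝ) (t : ℝ) :
    ContinuousOn (fun s => amount A s t) (Iic t) := by
  refine LipschitzOnWith.continuousOn (K := 1) (LipschitzOnWith.of_dist_le_mul fun x hx y hy => ?_)
  simp only [mem_Iic] at hx hy
  rw [Real.dist_eq, Real.dist_eq, NNReal.coe_one, one_mul]
  rcases le_total x y with h | h
  · rw [← amount_add h hy, abs_sub_comm x y, add_sub_cancel_right,
      abs_of_nonneg (amount_nonneg _ _ _), abs_of_nonneg (sub_nonneg.2 h)]
    exact amount_le_sub A h
  · rw [← amount_add h hx, sub_add_cancel_right, abs_neg,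
      abs_of_nonneg (amount_nonneg _ _ _), abs_of_nonneg (sub_nonneg.2 h)]
    exact amount_le_sub A h

theorem continuousOn_amount_right (A : Set ℝ) (s : ℝ) :
    ContinuousOn (fun t => amount A s t) (Ici s) := by
  refine LipschitzOnWith.continuousOn (K := 1) (LipschitzOnWith.of_dist_le_mul fun x hx y hy => ?_)
  simp only [mem_Ici] at hx hy
  rw [Real.dist_eq, Real.dist_eq, NNReal.coe_one, one_mul]
  rcases le_total x y with h | h
  · rw [← amount_add hx h, sub_add_cancel_left, abs_neg, abs_sub_comm x y,
      abs_of_nonneg (amount_nonneg _ _ _), abs_of_nonneg (sub_nonneg.2 h)]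
    exact amount_le_sub A h
  · rw [← amount_add hy h, add_sub_cancel_left,
      abs_of_nonneg (amount_nonneg _ _ _), abs_of_nonneg (sub_nonneg.2 h)]
    exact amount_le_sub A h

namespace GlobalFP

variable {N : ℕ}

theorem Schedule.service_eq_amount (S : Schedule N) (i : Fin N) (j : ℕ) (t : ℝ) :
    S.service i j t = amount (S i j) 0 t := rfl

/-! ### Consequences of the scheduling rule -/

/-- The times at which some job of task `i` is executed. -/
def Schedule.running (S : Schedule N) (i : Fin N) : Set ℝ := ⋃ j, S i j

theorem Finished.mono {P : JobPattern N} {S : Schedule N} {i : Fin N} {j : ℕ} {s t : ℝ}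
    (h : Finished P S i j s) (hst : s ≤ t) : Finished P S i j t := by
  refine le_trans h (amount_le_of_inter_subset ?_)
  rintro x ⟨hx, h0, hs⟩
  exact ⟨hx, h0, hs.trans_le hst⟩

theorem JobPattern.IsLegal.release_add_mul_le {P : JobPattern N} {τ : Fin N → SporadicTask}
    (hP : P.IsLegal τ) (i : Fin N) (j n : ℕ) :
    P.release i j + n * (τ i).T ≤ P.release i (j + n) := by
  induction n with
  | zero => simp
  | succ n ih =>
    have := hP.separation i (j + n)
    rw [← add_assoc]
    push_cast
    linarith

theorem JobPattern.IsLegal.release_mono {P : JobPattern N} {τ : Fin N → SporadicTask}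
    (hP : P.IsLegal τ) (i : Fin N) : Monotone (P.release i) :=
  monotone_nat_of_le_succ fun j => by linarith [hP.separation i j, (τ i).T_pos]

theorem Active.exists_ready {P : JobPattern N} {S : Schedule N} {τ : Fin N → SporadicTask}
    (hP : P.IsLegal τ) {i : Fin N} {t : ℝ} (h : Active P S i t) : ∃ j, Ready P S i j t := by
  classical
  obtain ⟨j, hj, hn⟩ := h
  have hex : ∃ j, ¬ Finished P S i j t := ⟨j, hn⟩
  refine ⟨Nat.find hex, (hP.release_mono i (Nat.find_min' hex hn)).trans hj, Nat.find_spec hex,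
    fun j' hj' => ?_⟩
  simpa using Nat.find_min hex hj'

theorem IsGlobalFPSchedule.measurableSet_running {M : ℕ} {P : JobPattern N} {S : Schedule N}
    (hS : IsGlobalFPSchedule M P S) (i : Fin N) : MeasurableSet (S.running i) :=
  MeasurableSet.iUnion fun j => hS.measurable i j

theorem IsGlobalFPSchedule.ready {M : ℕ} {P : JobPattern N} {S : Schedule N}
    (hS : IsGlobalFPSchedule M P S) {i : Fin N} {j : ℕ} {t : ℝ} (h : t ∈ S i j) :
    Ready P S i j t := ((hS.executes_iff i j t).1 h).1

/-- If task `i` is active but not running, then `M` tasks of higher priority are running. -/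
theorem IsGlobalFPSchedule.exists_running {M : ℕ} {P : JobPattern N} {S : Schedule N}
    {τ : Fin N → SporadicTask} (hS : IsGlobalFPSchedule M P S) (hP : P.IsLegal τ) {t : ℝ}
    (i : Fin N) (hact : Active P S i t) (hrun : t ∉ S.running i) :
    ∃ G ⊆ Finset.Iio i, M ≤ G.card ∧ ∀ h ∈ G, t ∈ S.running h := by
  classical
  induction i using WellFoundedLT.induction with
  | ind i ih =>
    -- Either all active higher-priority tasks run, and there are at least M of them, or a waiting
    -- one inherits the claim by induction.
    by_cases hall : ∀ h < i, Active P S h t → t ∈ S.running h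
    · obtain ⟨j, hj⟩ := hact.exists_ready hP
      have hnot : t ∉ S i j := fun h => hrun (mem_iUnion.2 ⟨j, h⟩)
      rw [hS.executes_iff, not_and, not_lt] at hnot
      refine ⟨Finset.univ.filter fun h => h < i ∧ Active P S h t, fun h hh => ?_, ?_,
        fun h hh => ?_⟩
      · simp only [Finset.mem_filter] at hh
        simpa using hh.2.1
      · have := hnot hj
        rwa [Set.ncard_eq_toFinset_card', Set.toFinset_ofPred] at this
      · simp only [Finset.mem_filter] at hh
        exact hall h hh.2.1 hh.2.2
    · push Not at hall
      obtain ⟨h, hhi, hh, hr⟩ := hall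
      obtain ⟨G, hG, hGM, hGr⟩ := ih h hhi hh hr
      exact ⟨G, hG.trans (Finset.Iio_subset_Iio hhi.le), hGM, hGr⟩

/-- While task `i` is active and not running, `M` tasks of higher priority are running. -/
theorem IsGlobalFPSchedule.mul_sub_le_sum_amount {M : ℕ} {P : JobPattern N} {S : Schedule N}
    {τ : Fin N → SporadicTask} (hS : IsGlobalFPSchedule M P S) (hP : P.IsLegal τ) {s t : ℝ}
    (hst : s ≤ t) (i : Fin N) (hact : ∀ u, s ≤ u → u < t → Active P S i u) :
    M * (t - s - amount (S.running i) s t) ≤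
      ∑ h ∈ Finset.Iio i, amount (S.running h) s t := by
  have hB : MeasurableSet (Ico s t \ S.running i) :=
    measurableSet_Ico.diff (hS.measurableSet_running i)
  have key := mul_measureReal_le_sum_inter volume (Finset.Iio i) S.running
    (Ico s t \ S.running i) M (fun h _ => hS.measurableSet_running h) hB
    (measure_ne_top_of_subset sdiff_subset (by simp))
    fun x hx => hS.exists_running hP i (hact x hx.1.1 hx.1.2) hx.2
  have hvol : volume.real (Ico s t \ S.running i) = t - s - amount (S.running i) s t := by
    have := measureReal_inter_add_sdiff (μ := volume) (s := Ico s t) (hS.measurableSet_running i)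
      (by simp)
    rw [Real.volume_real_Ico_of_le hst, inter_comm] at this
    rw [amount]; linarith
  rw [hvol] at key
  refine key.trans (Finset.sum_le_sum fun h _ => ?_)
  exact measureReal_mono (inter_subset_inter_right _ sdiff_subset) (volume_inter_Ico_ne_top _ _ _)

/-- A job never receives more service than it needs. -/
theorem IsGlobalFPSchedule.service_le_exec {M : ℕ} {P : JobPattern N} {S : Schedule N}
    {τ : Fin N → SporadicTask} (hS : IsGlobalFPSchedule M P S) (hP : P.IsLegal τ)
    (i : Fin N) (j : ℕ) {t : ℝ} (ht : 0 ≤ t) : S.service i j t ≤ P.exec i j := by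
  by_contra! hlt
  have h0 : amount (S i j) 0 0 = 0 := amount_eq_zero fun x _ h => not_lt.2 h
  -- At u the service equals the requirement exactly; from then on the job is finished and cannot
  -- run.
  obtain ⟨u, ⟨hu0, hut⟩, hu⟩ := intermediate_value_Icc ht
    ((continuousOn_amount_right (S i j) 0).mono fun x hx => hx.1)
    (show P.exec i j ∈ Icc (amount (S i j) 0 0) (amount (S i j) 0 t) from
      ⟨h0.le.trans (hP.exec_nonneg i j), hlt.le⟩)
  have hz : amount (S i j) u t = 0 := amount_eq_zero fun x hx hux =>
    absurd (Finished.mono (le_of_eq hu.symm) hux) (hS.ready hx).2.1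
  have := amount_add (A := S i j) hu0 hut
  rw [S.service_eq_amount] at hlt
  simp only at hu
  linarith

theorem IsGlobalFPSchedule.amount_job_le {M : ℕ} {P : JobPattern N} {S : Schedule N}
    {τ : Fin N → SporadicTask} (hS : IsGlobalFPSchedule M P S) (hP : P.IsLegal τ)
    (i : Fin N) (j : ℕ) {s t : ℝ} (hs : 0 ≤ s) (hst : s ≤ t) :
    amount (S i j) s t ≤ (τ i).C :=
  calc amount (S i j) s t ≤ amount (S i j) 0 t :=
        amount_le_of_inter_subset fun _ hx => ⟨hx.1, hs.trans hx.2.1, hx.2.2⟩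
    _ ≤ P.exec i j := hS.service_le_exec hP i j (hs.trans hst)
    _ ≤ (τ i).C := hP.exec_le i j

/-- If in `[s, t)` only jobs from `F` of task `i` run, these account for the running time. -/
theorem amount_running_le_sum {S : Schedule N} {i : Fin N} {s t : ℝ} (F : Finset ℕ)
    (hF : ∀ j, ∀ x ∈ S i j, s ≤ x → x < t → j ∈ F) :
    amount (S.running i) s t ≤ ∑ j ∈ F, amount (S i j) s t := by
  have hsub : S.running i ∩ Ico s t ⊆ ⋃ j ∈ F, S i j ∩ Ico s t := by
    rintro x ⟨hx, hxs⟩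
    obtain ⟨j, hj⟩ := mem_iUnion.1 hx
    exact mem_biUnion (hF j x hj hxs.1 hxs.2) ⟨hj, hxs⟩
  refine (measureReal_mono hsub ?_).trans (measureReal_biUnion_finset_le F _)
  exact measure_ne_top_of_subset (iUnion₂_subset fun j _ => inter_subset_right)
    (by simp : volume (Ico s t) ≠ ⊤)

/-! ### Busy periods and workload bounds -/

/-- An unfinished job `j` lies in a busy period of its task, which starts with the release of a
job `j₀` at which all earlier jobs are finished. -/
theorem exists_busy_start {P : JobPattern N} {S : Schedule N} {i : Fin N} {j : ℕ} {t : ℝ}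
    (hj : ¬ Finished P S i j t) :
    ∃ j₀ ≤ j, (∀ j' < j₀, Finished P S i j' (P.release i j₀)) ∧
      ∀ u, P.release i j₀ ≤ u → u < t → Active P S i u := by
  classical
  have hex : ∃ n, ∀ u, P.release i n ≤ u → u < t → Active P S i u :=
    ⟨j, fun u hu hut => ⟨j, hu, fun h => hj (h.mono hut.le)⟩⟩
  refine ⟨Nat.find hex, Nat.find_min' hex fun u hu hut => ⟨j, hu, fun h => hj (h.mono hut.le)⟩,
    fun j' hj' => ?_, Nat.find_spec hex⟩
  by_contra hnf
  -- An unfinished `j'` would extend the busy period back to its own release, against minimality.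
  refine Nat.find_min hex hj' fun u hu hut => ?_
  rcases le_or_gt (P.release i (Nat.find hex)) u with h | h
  · exact Nat.find_spec hex u h hut
  · exact ⟨j', hu, fun hf => hnf (hf.mono h.le)⟩

/-- If all jobs of task `i` released before `s` are finished at `s`, then the task runs for at most
`U (t - s) + C - C U` time units in `[s, t)`. -/
theorem IsGlobalFPSchedule.amount_running_le {M : ℕ} {P : JobPattern N} {S : Schedule N}
    {τ : Fin N → SporadicTask} (hS : IsGlobalFPSchedule M P S) (hP : P.IsLegal τ)
    (i : Fin N) {s t : ℝ} (hs : 0 ≤ s) (hst : s ≤ t)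
    (hfin : ∀ j, P.release i j < s → Finished P S i j s) :
    amount (S.running i) s t ≤
      (τ i).U * (t - s) + ((τ i).C - (τ i).C * (τ i).U) := by
  classical
  have hT := (τ i).T_pos
  have hC := (τ i).C_pos
  have hex : ∃ j, s ≤ P.release i j := by
    obtain ⟨n, hn⟩ := exists_nat_ge (s / (τ i).T)
    rw [div_le_iff₀ hT] at hn
    have := hP.release_add_mul_le i 0 n
    exact ⟨0 + n, by linarith [hP.release_nonneg i 0]⟩
  obtain ⟨j₀, hj₀, hmin⟩ : ∃ j₀, s ≤ P.release i j₀ ∧ ∀ j < j₀, P.release i j < s :=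
    ⟨Nat.find hex, Nat.find_spec hex, fun j hj => not_le.1 (Nat.find_min hex hj)⟩
  set q := ⌊(t - s) / (τ i).T⌋₊ with hq
  have hq1 : q * (τ i).T ≤ t - s := by
    rw [← le_div_iff₀ hT]
    exact Nat.floor_le (div_nonneg (sub_nonneg.2 hst) hT.le)
  have hq2 : t - s < (q + 1) * (τ i).T := by
    rw [← div_lt_iff₀ hT]
    exact Nat.lt_floor_add_one _
  have hrel : ∀ n : ℕ, s + n * (τ i).T ≤ P.release i (j₀ + n) := fun n => by
    linarith [hP.release_add_mul_le i j₀ n]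
  have hsum := amount_running_le_sum (S := S) (i := i) (s := s) (t := t)
    (Finset.Ico j₀ (j₀ + (q + 1))) fun j x hx hsx hxt => by
      have hr := hS.ready hx
      rw [Finset.mem_Ico]
      constructor
      · by_contra! hlt
        exact hr.2.1 ((hfin j (hmin j hlt)).mono hsx)
      · by_contra! hge
        have h1 := hrel (q + 1)
        have h2 := hP.release_mono i hge
        push_cast at h1
        linarith [hr.1]
  rw [Finset.sum_Ico_eq_sum_range, add_tsub_cancel_left, Finset.sum_range_succ] at hsum
  have h1 : ∑ n ∈ Finset.range q, amount (S i (j₀ + n)) s t ≤ q * (τ i).C := by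
    simpa using Finset.sum_le_card_nsmul (Finset.range q) _ (τ i).C
      fun n _ => hS.amount_job_le hP i (j₀ + n) hs hst
  have h2 : amount (S i (j₀ + q)) s t ≤ (τ i).C := hS.amount_job_le hP i _ hs hst
  have h3 : amount (S i (j₀ + q)) s t ≤ t - s - q * (τ i).T := by
    have ha : amount (S i (j₀ + q)) s t ≤ amount (S i (j₀ + q)) (s + q * (τ i).T) t :=
      amount_le_of_inter_subset fun x hx =>
        ⟨hx.1, (hrel q).trans (hS.ready hx.1).1, hx.2.2⟩
    have hb := amount_le_sub (S i (j₀ + q)) (s := s + q * (τ i).T) (t := t) (by linarith)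
    linarith
  have hU0 : 0 ≤ (τ i).U := div_nonneg hC.le hT.le
  have hU1 : (τ i).U ≤ 1 := (τ i).C_div_T_le_one
  have hUT : (τ i).U * (τ i).T = (τ i).C := div_mul_cancel₀ _ hT.ne'
  -- The last job gets at most min(C, r) with r = t - s - qT, hence at most the convex combination
  -- Ur + (1 - U)C.
  have h4 := mul_le_mul_of_nonneg_left h3 hU0
  have h5 := mul_le_mul_of_nonneg_left h2 (sub_nonneg.2 hU1)
  have h6 : (τ i).U * (q * (τ i).T) = q * (τ i).C := by rw [← hUT]; ring
  nlinarith [h4, h5, h6, hsum, h1]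

/-- A task of higher priority runs for at most `U (t - s) + C - C U` time units in `[s, t)`, if `s`
is the earliest possible start of an interval in which the system is loaded at the rate
`M - (M - 1) V`. -/
theorem IsGlobalFPSchedule.amount_running_le_of_rate {M : ℕ} {P : JobPattern N} {S : Schedule N}
    {τ : Fin N → SporadicTask} (hS : IsGlobalFPSchedule M P S) (hP : P.IsLegal τ) (hM : 2 ≤ M)
    {i k : Fin N} (hik : i < k) {s t V : ℝ} (hs : 0 ≤ s) (hst : s ≤ t) (hV : (τ i).U ≤ V)
    (hrate : ∀ u, 0 ≤ u → u < s →
      ∑ h ∈ Finset.Iio k, amount (S.running h) u s < (M - (M - 1) * V) * (s - u)) :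
    amount (S.running i) s t ≤
      (τ i).U * (t - s) + ((τ i).C - (τ i).C * (τ i).U) := by
  by_cases hfin : ∀ j, P.release i j < s → Finished P S i j s
  · exact hS.amount_running_le hP i hs hst hfin
  push Not at hfin
  obtain ⟨j, hjs, hj⟩ := hfin
  obtain ⟨j₀, hj₀, hprev, hact⟩ := exists_busy_start hj
  set u := P.release i j₀
  have hu0 : 0 ≤ u := hP.release_nonneg i j₀
  have hus : u < s := (hP.release_mono i hj₀).trans_lt hjs
  have h1 := hS.amount_running_le hP i hu0 (hus.le.trans hst) fun j hj =>
    hprev j ((hP.release_mono i).reflect_lt hj)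
  have h2 := hS.mul_sub_le_sum_amount hP hus.le i hact
  have h3 := hrate u hu0 hus
  have h4 : amount (S.running i) u s + ∑ h ∈ Finset.Iio i, amount (S.running h) u s ≤
      ∑ h ∈ Finset.Iio k, amount (S.running h) u s := by
    rw [← Finset.sum_insert (f := fun h => amount (S.running h) u s)
      (by simp : i ∉ Finset.Iio i)]
    refine Finset.sum_le_sum_of_subset_of_nonneg ?_ fun _ _ _ => amount_nonneg _ _ _
    intro h hh
    simp only [Finset.mem_insert, Finset.mem_Iio] at hh ⊢
    rcases hh with rfl | hh
    exacts [hik, hh.trans hik]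
  have h5 := amount_add (A := S.running i) hus.le hst
  have hM' : (2 : ℝ) ≤ M := by exact_mod_cast hM
  have h6 : V * (s - u) < amount (S.running i) u s := by
    refine lt_of_mul_lt_mul_left ?_ (by linarith : (0 : ℝ) ≤ M - 1)
    linarith
  have h7 := mul_le_mul_of_nonneg_right hV (sub_nonneg.2 hus.le)
  linarith

/-- The load condition that every deadline miss of task `k` would violate. -/
theorem IsGlobalFPSchedule.finished_of_forall_lt {M : ℕ} {P : JobPattern N} {S : Schedule N}
    {τ : Fin N → SporadicTask} (hS : IsGlobalFPSchedule M P S) (hP : P.IsLegal τ) (hM : 2 ≤ M)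
    {k : Fin N} (hDT : (τ k).T ≤ (τ k).D) {V : ℝ} (hVk : (τ k).U ≤ V)
    (hV : ∀ i < k, (τ i).U ≤ V)
    (hload : ∀ L, (τ k).D ≤ L →
      (τ k).C + (τ k).U * (L - (τ k).D)
        + ∑ i ∈ Finset.Iio k, ((τ i).U * L + ((τ i).C - (τ i).C * (τ i).U))
        ≤ (M - (M - 1) * V) * L) (j : ℕ) :
    Finished P S k j (P.release k j + (τ k).D) := by
  by_contra hj
  obtain ⟨j₀, hj₀, hprev, hact⟩ := exists_busy_start hj
  set d := P.release k j + (τ k).D with hd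
  set a := P.release k j₀ with ha
  have hT := (τ k).T_pos
  have hD := (τ k).D_pos
  have ha0 : 0 ≤ a := hP.release_nonneg k j₀
  have had : a ≤ d := by linarith [hP.release_mono k hj₀]
  obtain ⟨n, rfl⟩ := Nat.exists_eq_add_of_le hj₀
  have hlen : n * (τ k).T + (τ k).D ≤ d - a := by linarith [hP.release_add_mul_le k j₀ n]
  have hUT : (τ k).U * (τ k).T = (τ k).C := div_mul_cancel₀ _ hT.ne'
  have hU0 : 0 ≤ (τ k).U := div_nonneg (τ k).C_pos.le hT.le
  -- the demand of task `k` in its busy period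
  have hx : amount (S.running k) a d < (n + 1) * (τ k).C := by
    have hsum := amount_running_le_sum (S := S) (i := k) (s := a) (t := d)
      (Finset.Ico j₀ (j₀ + (n + 1))) fun j x hx hsx hxt => by
        have hr := hS.ready hx
        rw [Finset.mem_Ico]
        constructor
        · by_contra! hlt
          exact hr.2.1 ((hprev j hlt).mono hsx)
        · by_contra! hge
          exact hj ((hr.2.2 (j₀ + n) (by omega)).mono hxt.le)
    rw [Finset.sum_Ico_eq_sum_range, add_tsub_cancel_left, Finset.sum_range_succ] at hsum
    have h1 : ∑ m ∈ Finset.range n, amount (S k (j₀ + m)) a d ≤ n * (τ k).C := by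
      simpa using Finset.sum_le_card_nsmul (Finset.range n) _ (τ k).C
        fun m _ => hS.amount_job_le hP k (j₀ + m) ha0 had
    -- The missed deadline makes this strict, which yields the final contradiction.
    have h2 : amount (S k (j₀ + n)) a d < (τ k).C :=
      calc amount (S k (j₀ + n)) a d ≤ amount (S k (j₀ + n)) 0 d :=
            amount_le_of_inter_subset fun _ hx => ⟨hx.1, ha0.trans hx.2.1, hx.2.2⟩
        _ < P.exec k (j₀ + n) := not_le.1 hj
        _ ≤ (τ k).C := hP.exec_le k _
    linarith
  have hxU : (n + 1) * (τ k).C ≤ (τ k).C + (τ k).U * (d - a - (τ k).D) := by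
    have := mul_le_mul_of_nonneg_left hlen hU0
    have h : (τ k).U * (n * (τ k).T) = n * (τ k).C := by rw [← hUT]; ring
    linarith
  have hM' : (2 : ℝ) ≤ M := by exact_mod_cast hM
  have hxV : amount (S.running k) a d ≤ V * (d - a) := by
    have h1 := mul_le_mul_of_nonneg_left hDT hU0
    have h2 := mul_le_mul_of_nonneg_right hVk (sub_nonneg.2 had)
    linarith
  -- the earliest start of a loaded interval
  set w : ℝ → ℝ := fun u => ∑ h ∈ Finset.Iio k, amount (S.running h) u d with hw
  have hcont : ContinuousOn (fun u => w u + amount (S.running k) a d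
      - (M - (M - 1) * V) * (d - u)) (Icc 0 a) := by
    refine ContinuousOn.sub (ContinuousOn.add (continuousOn_finsetSum _ fun h _ => ?_)
      continuousOn_const) (by fun_prop)
    exact (continuousOn_amount_left _ d).mono fun x hx => hx.2.trans had
  have hcomp : IsCompact (Icc 0 a ∩ (fun u => w u + amount (S.running k) a d
      - (M - (M - 1) * V) * (d - u)) ⁻¹' Ici 0) :=
    isCompact_Icc.of_isClosed_subset (hcont.preimage_isClosed_of_isClosed isClosed_Icc isClosed_Ici)
      inter_subset_left
  obtain ⟨s, ⟨⟨hs0, hsa⟩, hs⟩, hleast⟩ := hcomp.exists_isLeast ⟨a, ⟨ha0, le_rfl⟩, by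
    have h1 := hS.mul_sub_le_sum_amount hP had k hact
    have h2 := mul_le_mul_of_nonneg_left hxV (by linarith : (0 : ℝ) ≤ M - 1)
    simp only [hw, mem_preimage, mem_Ici]
    linarith⟩
  have hsd := hsa.trans had
  simp only [mem_preimage, mem_Ici] at hs
  have hsplit : ∀ u, u ≤ s → w u = ∑ h ∈ Finset.Iio k, amount (S.running h) u s + w s := by
    intro u hu
    rw [hw, ← Finset.sum_add_distrib]
    exact Finset.sum_congr rfl fun h _ => (amount_add hu hsd).symm
  have hbound : w s ≤ ∑ i ∈ Finset.Iio k,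
      ((τ i).U * (d - s) + ((τ i).C - (τ i).C * (τ i).U)) := by
    refine Finset.sum_le_sum fun i hi => ?_
    rw [Finset.mem_Iio] at hi
    -- If [u, s) met the rate, adding it to [s, d) would make u an earlier loaded start.
    refine hS.amount_running_le_of_rate hP hM hi hs0 hsd (hV i hi) fun u hu0 hus => ?_
    by_contra! hge
    refine hus.not_ge (hleast ⟨⟨hu0, hus.le.trans hsa⟩, ?_⟩)
    simp only [mem_preimage, mem_Ici, hsplit u hus.le]
    linarith
  -- Task k is counted only on [a, d); its bound is relaxed to the longer window [s, d).
  have hmono := mul_le_mul_of_nonneg_left (sub_le_sub_left hsa d) hU0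
  have := hload (d - s) (by
    have : 0 ≤ n * (τ k).T := by positivity
    linarith)
  linarith

/-! ### The two cases -/

theorem le_UmaxDelta (τ : Fin N → SporadicTask) {i k : Fin N} (h : i < k) :
    (τ i).U ≤ UmaxDelta τ k :=
  (Finset.le_fold_max _).2 (Or.inr ⟨i, Finset.mem_Iio.2 h, le_rfl⟩)

theorem density_le_UmaxDelta (τ : Fin N → SporadicTask) (k : Fin N) :
    (τ k).density ≤ UmaxDelta τ k :=
  (Finset.le_fold_max _).2 (Or.inl le_rfl)

end GlobalFP

theorem theorem4p6 {N : ℕ} (τ : Fin N → SporadicTask) (M : ℕ) (hM : 2 ≤ M) (k : Fin N)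
    (hDT : (τ k).T < (τ k).D) (b : ℝ) (hb : b = ((τ k).D - (τ k).T) / (τ k).T) :
    (0 < b * (τ k).U - ∑ i ∈ Finset.Iio k, ((τ i).C - (τ i).C * (τ i).U) / (τ k).T →
      ∑ i ∈ Finset.Iic k, (τ i).U ≤ (M : ℝ) - ((M : ℝ) - 1) * GlobalFP.UmaxDelta τ k →
      GlobalFP.Schedulable M τ k) ∧
    (¬ 0 < b * (τ k).U - ∑ i ∈ Finset.Iio k, ((τ i).C - (τ i).C * (τ i).U) / (τ k).T →
      (τ k).C / (τ k).D
          + ∑ i ∈ Finset.Iio k, (((τ i).C - (τ i).C * (τ i).U) / (τ k).D + (τ i).U)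
        ≤ (M : ℝ) - ((M : ℝ) - 1) * GlobalFP.UmaxDelta τ k →
      GlobalFP.Schedulable M τ k) := by
  have hT := (τ k).T_pos
  have hD := (τ k).D_pos
  have hVk : (τ k).U ≤ GlobalFP.UmaxDelta τ k := by
    have := GlobalFP.density_le_UmaxDelta τ k
    rwa [SporadicTask.density, min_eq_right hDT.le] at this
  have hUT : (τ k).U * (τ k).T = (τ k).C := div_mul_cancel₀ _ hT.ne'
  set A := ∑ i ∈ Finset.Iio k, ((τ i).C - (τ i).C * (τ i).U) with hA
  -- The case distinction is on the sign of C_k + A - U_k D_k, the constant term of the load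
  -- condition: if negative it is dropped.
  have hbA : (b * (τ k).U - A / (τ k).T) * (τ k).T = (τ k).U * (τ k).D - (τ k).C - A := by
    rw [hb, ← hUT]
    field_simp
  rw [← Finset.sum_div, ← hA, Finset.sum_add_distrib, ← Finset.sum_div, ← hA,
    ← Finset.Iio_insert k, Finset.sum_insert (by simp)]
  refine ⟨fun hpos hle P S hP hS => ?_, fun hneg hle P S hP hS => ?_⟩
  all_goals
    refine hS.finished_of_forall_lt hP hM hDT.le hVk (fun i hi => GlobalFP.le_UmaxDelta τ hi)
      fun L hL => ?_
    rw [Finset.sum_add_distrib, ← hA, ← Finset.sum_mul]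
    have h2 := mul_le_mul_of_nonneg_right hle (hD.le.trans hL)
  · have h1 := mul_pos hpos hT
    linarith
  · have h1 : 0 ≤ (τ k).C + A - (τ k).U * (τ k).D := by
      have := mul_nonneg (sub_nonneg.2 (not_lt.1 hneg)) hT.le
      linarith
    -- A nonnegative constant term weighs most, relative to L, at L = D_k.
    have h3 : (τ k).C + A - (τ k).U * (τ k).D ≤
        ((τ k).C + A - (τ k).U * (τ k).D) / (τ k).D * L := by
      rw [div_mul_eq_mul_div, le_div_iff₀ hD]
      exact mul_le_mul_of_nonneg_left hL h1
    have h4 : ((τ k).C + A - (τ k).U * (τ k).D) / (τ k).D =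
        (τ k).C / (τ k).D + A / (τ k).D - (τ k).U := by field_simp
    rw [h4] at h3
    linarith
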